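/- Let $C_m=\frac{1}{m+1}\binom{2m}{m}$ denote the $m$-th Catalan number. Consider a convex $n$-gon with labelled vertices. A triangulation of it is a set of $n-3$ pairwise noncrossing diagonals; it is viewed as a graph on the $n$ vertices whose edges are the $n$ sides of the polygon together with these diagonals. A cycle of length $k$ in a triangulation is a subgraph of this graph that is a cycle on $k$ vertices. Let $3\le k<n$. Then the average number of cycles of length $k$ in a triangulation of the $n$-gon, taken over all triangulations with equal weight, is $$\binom{2n-k-1}{n-1}\,\frac{C_{k-2}}{C_{n-2}}.$$ -/

import Mathlib

/-!
Dissections of a convex `n`-gon. The vertices of the polygon are labelled `0, 1, …, n - 1` (the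
elements of `Fin n`) in cyclic order along the boundary, so that its sides are the edges of
`SimpleGraph.cycleGraph n`.
-/

namespace PolygonDissection

/-- A diagonal of the `n`-gon: an unordered pair of distinct vertices that is not a side. -/
def IsDiagonal {n : ℕ} (e : Sym2 (Fin n)) : Prop :=
  ¬ e.IsDiag ∧ e ∉ (SimpleGraph.cycleGraph n).edgeSet

/-- Two chords of a convex polygon cross (meet in a point interior to both) if and only if their
end points are four distinct vertices that alternate along the boundary. -/
def Cross {n : ℕ} (e f : Sym2 (Fin n)) : Prop :=
  ∃ a b c d : Fin n, a < b ∧ b < c ∧ c < d ∧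
    ((e = s(a, c) ∧ f = s(b, d)) ∨ (e = s(b, d) ∧ f = s(a, c)))

/-- A `k`-dissection of the `n`-gon, given by its `k` pairwise noncrossing diagonals. -/
def IsDissection {n : ℕ} (k : ℕ) (D : Finset (Sym2 (Fin n))) : Prop :=
  D.card = k ∧ (∀ e ∈ D, IsDiagonal e) ∧ ∀ e ∈ D, ∀ f ∈ D, ¬ Cross e f

/-- A triangulation of the `n`-gon (`3 ≤ n`) is an `(n - 3)`-dissection. -/
def IsTriangulation {n : ℕ} (D : Finset (Sym2 (Fin n))) : Prop :=
  IsDissection (n - 3) D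

open Classical in
/-- The finite set of all triangulations of the `n`-gon with labelled vertices. -/
noncomputable def triangulations (n : ℕ) : Finset (Finset (Sym2 (Fin n))) :=
  Finset.univ.filter IsTriangulation

/-- The graph drawn by a dissection: its edges are the sides of the polygon and the chosen
diagonals. -/
def graph {n : ℕ} (D : Finset (Sym2 (Fin n))) : SimpleGraph (Fin n) :=
  SimpleGraph.cycleGraph n ⊔ SimpleGraph.fromEdgeSet (D : Set (Sym2 (Fin n)))

/-- The number of cycles of length `k` (`3 ≤ k`) in a graph `G`: the number of subgraphs of `G`
that are isomorphic to the cycle graph on `k` vertices. -/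
noncomputable def numCycles {V : Type*} [Fintype V] (G : SimpleGraph V) (k : ℕ) : ℕ :=
  G.copyCount (SimpleGraph.cycleGraph k)

/-- The average number of cycles of length `k`, taken over all triangulations of the `n`-gon. -/
noncomputable def averageCycles (n k : ℕ) : ℚ :=
  (∑ D ∈ triangulations n, (numCycles (graph D) k : ℚ)) / ((triangulations n).card : ℚ)

end PolygonDissection

/-!
A triangulation splits at the triangle on the base edge `{0, n - 1}`, which identifies the
triangulations with the binary trees with `n - 2` nodes. Since its edges do not cross, a cycle in a
triangulation is the boundary of the convex polygon on its vertices, so it is determined by its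
vertex set. If the third vertex of the base triangle is `m`, a cycle lies on one side of `m` or
passes through both ends of the base edge and through `m`, and in the last case it consists of the
base edge and of two monotone paths. With `x` marking triangles, `y` marking edges and `C` the
Catalan series in `x`, the generating functions `P` of these paths and `Z` of the cycles satisfy
`P = yC + xP²` and `Z = 2xCZ + P - yC`. The coefficient of `y ^ (l + 1)` in `P` is
`catalan l * x ^ l * C ^ (l + 1)`, and the coefficients of `C ^ r / (1 - 2xC)` are the binomial
coefficients `(2m + r).choose m`, which follows from Pascal's rule.
-/

namespace PolygonDissection

section GeneratingFunctions

open PowerSeries Finset BinaryTree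

variable {R : Type*} [CommRing R]

/-- The generating function of the Catalan numbers. -/
noncomputable def catalanGF : R⟦X⟧ := mk fun m => (catalan m : R)

theorem catalanGF_eq : (catalanGF : R⟦X⟧) = 1 + X * catalanGF ^ 2 := by
  have hmap : PowerSeries.map (Nat.castRingHom R) catalanSeries = catalanGF := by
    ext m
    simp [catalanGF]
  have h := congrArg (PowerSeries.map (Nat.castRingHom R)) catalanSeries_sq_mul_X_add_one
  simp only [map_add, map_mul, map_pow, map_one, map_X, hmap] at h
  linear_combination -h

/-- The generating function of the binomial coefficients `(2m + r).choose m`, which equals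
`catalanGF ^ r / (1 - 2 * X * catalanGF)`. -/
noncomputable def chooseGF (r : ℕ) : R⟦X⟧ := mk fun m => ((2 * m + r).choose m : R)

theorem chooseGF_succ (r : ℕ) :
    (chooseGF (r + 1) : R⟦X⟧) = chooseGF r + X * chooseGF (r + 2) := by
  ext m
  cases m with
  | zero => simp [chooseGF]
  | succ m =>
    simp only [map_add, coeff_succ_X_mul, chooseGF, coeff_mk]
    rw [show 2 * (m + 1) + (r + 1) = (2 * m + (r + 2)) + 1 by ring, Nat.choose_succ_succ,
      show 2 * (m + 1) + r = 2 * m + (r + 2) by ring]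
    push_cast
    ring

theorem chooseGF_zero : (chooseGF 0 : R⟦X⟧) = 1 + X * (2 * chooseGF 1) := by
  ext m
  cases m with
  | zero => simp [chooseGF]
  | succ m =>
    have hpascal : (2 * (m + 1)).choose (m + 1) = 2 * (2 * m + 1).choose m := by
      rw [show 2 * (m + 1) = (2 * m + 1) + 1 by ring, Nat.choose_succ_succ, Nat.choose_symm_half]
      ring
    rw [← map_ofNat (C (R := R)) 2, map_add, coeff_succ_X_mul, coeff_C_mul, coeff_one]
    simp [chooseGF, hpascal]

theorem eq_zero_of_pascal {E : ℕ → R⟦X⟧} (h_zero : E 0 = X * (2 * E 1))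
    (h_succ : ∀ r, E (r + 1) = E r + X * E (r + 2)) (r : ℕ) : E r = 0 := by
  suffices h : ∀ m r, coeff m (E r) = 0 by
    ext m
    rw [h m r, map_zero]
  intro m
  induction m with
  | zero =>
    intro r
    induction r with
    | zero => rw [h_zero, coeff_zero_X_mul]
    | succ r ih => rw [h_succ, map_add, ih, coeff_zero_X_mul, add_zero]
  | succ m ihm =>
    intro r
    induction r with
    | zero => rw [h_zero, coeff_succ_X_mul, two_mul, map_add, ihm, add_zero]
    | succ r ih => rw [h_succ, map_add, ih, coeff_succ_X_mul, ihm, add_zero]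

theorem chooseGF_mul (r : ℕ) :
    (chooseGF r : R⟦X⟧) * (1 - 2 * X * catalanGF) = catalanGF ^ r := by
  have h := eq_zero_of_pascal (E := fun r =>
    (chooseGF r : R⟦X⟧) * (1 - 2 * X * catalanGF) - catalanGF ^ r) ?_ (fun r => ?_) r
  · exact sub_eq_zero.mp h
  · linear_combination (1 - 2 * X * catalanGF) * chooseGF_zero (R := R)
  · linear_combination (1 - 2 * X * catalanGF) * chooseGF_succ (R := R) r
      - catalanGF ^ r * catalanGF_eq (R := R)

/-- The bivariate generating function of a family of power series `w t` indexed by binary trees: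
the coefficient of the outer variable is taken in `w t`, the inner variable marks the nodes
of `t`. -/
noncomputable def treeGF (w : BinaryTree Unit → R⟦X⟧) : R⟦X⟧⟦X⟧ :=
  mk fun l => mk fun m => ∑ t ∈ treesOfNumNodesEq m, coeff l (w t)

theorem treeGF_add (v w : BinaryTree Unit → R⟦X⟧) : treeGF (v + w) = treeGF v + treeGF w := by
  ext l m
  simp [treeGF, sum_add_distrib]

theorem treeGF_const (a : R⟦X⟧) :
    treeGF (fun _ => a) = C catalanGF * PowerSeries.map C a := by
  ext l m
  simp [treeGF, catalanGF, coeff_C_mul, coeff_mul_C, treesOfNumNodesEq_card_eq_catalan]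

theorem sum_treesOfNumNodesEq_succ {M : Type*} [AddCommMonoid M] (m : ℕ)
    (F : BinaryTree Unit → M) :
    ∑ t ∈ treesOfNumNodesEq (m + 1), F t =
      ∑ p ∈ antidiagonal m, ∑ a ∈ treesOfNumNodesEq p.1, ∑ b ∈ treesOfNumNodesEq p.2,
        F (a △ b) := by
  rw [treesOfNumNodesEq_succ, sum_biUnion]
  · exact sum_congr rfl fun p _ => by rw [sum_map, sum_product]; rfl
  · simp_rw [Set.PairwiseDisjoint, Set.Pairwise, disjoint_left]
    aesop

/-- The weight of a tree that is the product of given weights of its two subtrees. -/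
def nodeWeight {A : Type*} [MulZeroClass A] (v w : BinaryTree Unit → A) : BinaryTree Unit → A
  | nil => 0
  | node _ a b => v a * w b

theorem treeGF_nodeWeight (v w : BinaryTree Unit → R⟦X⟧) :
    treeGF (nodeWeight v w) = C X * (treeGF v * treeGF w) := by
  ext l m
  rw [coeff_C_mul]
  cases m with
  | zero => simp [treeGF, nodeWeight]
  | succ m =>
    rw [coeff_succ_X_mul]
    simp only [treeGF, coeff_mul, map_sum, coeff_mk, sum_mul_sum, sum_treesOfNumNodesEq_succ,
      nodeWeight]
    symm
    rw [sum_comm]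
    refine sum_congr rfl fun p _ => ?_
    rw [sum_comm]
    exact sum_congr rfl fun a _ => sum_comm

/-- The generating function, in terms of `y`, of the paths that join the end points of the base
edge of the triangulation belonging to a binary tree and follow the order of the vertices; `y`
marks the edges of a path. -/
def pathWeight {A : Type*} [CommSemiring A] (y : A) : BinaryTree Unit → A
  | nil => y
  | node _ a b => y + pathWeight y a * pathWeight y b

/-- The generating function, in terms of `y`, of the cycles in the triangulation belonging to a
binary tree; a cycle of length `l + 1` contributes `y ^ l`. -/
def cycleWeight {A : Type*} [CommSemiring A] (y : A) : BinaryTree Unit → A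
  | nil => 0
  | node _ a b => cycleWeight y a + cycleWeight y b + pathWeight y a * pathWeight y b

theorem treeGF_pathWeight_eq : treeGF (pathWeight (X : R⟦X⟧)) =
    C catalanGF * X + C X * treeGF (pathWeight (X : R⟦X⟧)) ^ 2 := by
  have h : pathWeight (X : R⟦X⟧) = (fun _ => X) + nodeWeight (pathWeight X) (pathWeight X) := by
    funext t
    cases t <;> simp [pathWeight, nodeWeight]
  conv_lhs => rw [h]
  rw [treeGF_add, treeGF_const, treeGF_nodeWeight, map_X, sq]

theorem treeGF_cycleWeight_eq : treeGF (cycleWeight (X : R⟦X⟧)) * (1 - 2 * C X * C catalanGF) =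
    treeGF (pathWeight X) - C catalanGF * X := by
  have h : cycleWeight (X : R⟦X⟧) = nodeWeight (cycleWeight X) (fun _ => 1) +
      nodeWeight (fun _ => 1) (cycleWeight X) + nodeWeight (pathWeight X) (pathWeight X) := by
    funext t
    cases t <;> simp [cycleWeight, nodeWeight]
  have hZ := congrArg treeGF h
  simp only [treeGF_add, treeGF_nodeWeight, treeGF_const, map_one, mul_one] at hZ
  linear_combination hZ - treeGF_pathWeight_eq (R := R)

theorem eq_of_eq_add_X_mul_sq {p f g : R⟦X⟧⟦X⟧} (hf : f = p + C X * f ^ 2)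
    (hg : g = p + C X * g ^ 2) : f = g := by
  have hunit : IsUnit (1 - C X * (f + g)) := by
    simp [PowerSeries.isUnit_iff_constantCoeff]
  refine sub_eq_zero.mp (hunit.mul_left_eq_zero.mp ?_)
  linear_combination hf - hg

theorem treeGF_pathWeight : treeGF (pathWeight (X : R⟦X⟧)) =
    C catalanGF * X * rescale (X * catalanGF) catalanGF := by
  refine eq_of_eq_add_X_mul_sq treeGF_pathWeight_eq ?_
  have h := congrArg (rescale (X * catalanGF : R⟦X⟧)) (catalanGF_eq (R := R⟦X⟧))
  simp only [map_add, map_mul, map_pow, map_one, rescale_X] at h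
  linear_combination C catalanGF * X * h

theorem coeff_treeGF_pathWeight (l : ℕ) : coeff (l + 1) (treeGF (pathWeight (X : R⟦X⟧))) =
    (catalan l : R⟦X⟧) * X ^ l * catalanGF ^ (l + 1) := by
  rw [treeGF_pathWeight, mul_assoc, coeff_C_mul, coeff_succ_X_mul, coeff_rescale]
  simp only [catalanGF, coeff_mk]
  ring

theorem coeff_treeGF_cycleWeight {l : ℕ} (hl : 1 ≤ l) :
    coeff (l + 1) (treeGF (cycleWeight (X : R⟦X⟧))) =
      (catalan l : R⟦X⟧) * X ^ l * chooseGF (l + 1) := by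
  have h := congrArg (coeff (l + 1)) (treeGF_cycleWeight_eq (R := R))
  have hD : (1 - 2 * C X * C catalanGF : R⟦X⟧⟦X⟧) = C (1 - 2 * X * catalanGF) := by
    rw [map_sub, map_mul, map_mul, map_one, map_ofNat]
  have hX : coeff (l + 1) (C catalanGF * X : R⟦X⟧⟦X⟧) = 0 := by
    rw [coeff_C_mul, coeff_X, if_neg (by omega), mul_zero]
  rw [hD, coeff_mul_C, map_sub, coeff_treeGF_pathWeight, hX, sub_zero] at h
  have hunit : (chooseGF 0 : R⟦X⟧) * (1 - 2 * X * catalanGF) = 1 := chooseGF_mul 0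
  have hreg := (IsUnit.of_mul_eq_one_right _ hunit).mul_left_injective
  apply hreg
  linear_combination h - (catalan l : R⟦X⟧) * X ^ l * chooseGF_mul (R := R) (l + 1)

theorem sum_coeff_cycleWeight {n k : ℕ} (hk : 3 ≤ k) (hkn : k ≤ n) :
    ∑ t ∈ treesOfNumNodesEq (n - 2), coeff (k - 1) (cycleWeight (X : R⟦X⟧) t) =
      ((2 * n - k - 1).choose (n - 1) : R) * (catalan (k - 2) : R) := by
  obtain ⟨l, rfl⟩ : ∃ l, k = l + 2 := ⟨k - 2, by omega⟩
  obtain ⟨m, rfl⟩ : ∃ m, n = m + l + 2 := ⟨n - l - 2, by omega⟩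
  have h := congrArg (coeff (m + l)) (coeff_treeGF_cycleWeight (R := R) (l := l) (by omega))
  rw [mul_assoc, ← map_natCast C, coeff_C_mul, coeff_X_pow_mul] at h
  simp only [treeGF, chooseGF, coeff_mk] at h
  rw [Nat.add_sub_cancel, Nat.add_sub_cancel, show l + 2 - 1 = l + 1 by omega, h,
    show 2 * (m + l + 2) - (l + 2) - 1 = 2 * m + (l + 1) by omega,
    show m + l + 2 - 1 = 2 * m + (l + 1) - m by omega, Nat.choose_symm (by omega), mul_comm]

end GeneratingFunctions

section ConvexPolygons

open SimpleGraph

theorem cycleGraph_adj_of_lt {n : ℕ} {u v : Fin n} (h : u < v) :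
    (cycleGraph n).Adj u v ↔ v.val = u.val + 1 ∨ (u.val = 0 ∧ v.val + 1 = n) := by
  rw [cycleGraph_adj', Fin.coe_sub_iff_lt.mpr h, Fin.coe_sub_iff_le.mpr h.le]
  rw [Fin.lt_def] at h
  omega

theorem preconnected_induce_compl_cycleGraph {k : ℕ} {i j : Fin k} (hij : (cycleGraph k).Adj i j) :
    ((cycleGraph k).induce {i, j}ᶜ).Preconnected := by
  obtain ⟨m, rfl⟩ : ∃ m, k = m + 2 :=
    ⟨k - 2, by have := i.2; have := j.2; have := Fin.val_ne_of_ne hij.ne; omega⟩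
  wlog hsucc : j - i = 1 generalizing i j
  · rw [Set.pair_comm]
    exact this hij.symm ((cycleGraph_adj.mp hij).resolve_right hsucc)
  obtain rfl : j = i + 1 := eq_add_of_sub_eq' hsucc
  have hi {e : Fin (m + 2)} : i + 1 + e = i ↔ e = Fin.last (m + 1) := by
    rw [add_assoc, add_eq_left, add_comm 1 e, ← Fin.last_add_one, add_left_inj]
  let f : pathGraph m →g (cycleGraph (m + 2)).induce {i, i + 1}ᶜ :=
    { toFun t := ⟨i + 1 + t.succ.castSucc, by
        simp only [Set.mem_compl_iff, Set.mem_insert_iff, Set.mem_singleton_iff, hi, add_eq_left,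
          not_or, Fin.ext_iff, Fin.val_castSucc, Fin.val_succ, Fin.val_last, Fin.val_zero]
        omega⟩
      map_rel' {s t} hst := by
        rw [pathGraph_adj] at hst
        simp only [comap_adj, Function.Embedding.subtype_apply, cycleGraph_adj,
          add_sub_add_left_eq_sub, sub_eq_iff_eq_add', Fin.ext_iff, Fin.val_castSucc, Fin.val_succ]
        rw [Fin.val_add_one_of_lt (Fin.castSucc_lt_last _),
          Fin.val_add_one_of_lt (Fin.castSucc_lt_last _)]
        simp only [Fin.val_castSucc, Fin.val_succ]
        omega }
  refine (pathGraph_preconnected m).map f ?_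
  rintro ⟨b, hb⟩
  have he : i + 1 + (b - (i + 1)) = b := by abel
  generalize b - (i + 1) = e at he
  subst he
  simp only [Set.mem_compl_iff, Set.mem_insert_iff, Set.mem_singleton_iff, hi, add_eq_left,
    not_or, Fin.ext_iff, Fin.val_last, Fin.val_zero] at hb
  refine ⟨⟨e.val - 1, by omega⟩, Subtype.ext (congrArg (i + 1 + ·) (Fin.ext ?_))⟩
  simp
  omega

theorem map_eq_map_of_le {V W : Type*} [Finite V] {G : SimpleGraph V} {f g : V ↪ W}
    (h : G.map f ≤ G.map g) : G.map f = G.map g := by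
  rw [← edgeSet_inj]
  refine Set.eq_of_subset_of_ncard_le (edgeSet_mono h) ?_ ?_
  · simp only [edgeSet_map, Set.ncard_image_of_injective _ (Function.Embedding.injective _),
      le_refl]
  · rw [edgeSet_map]
    exact (Set.toFinite _).image _

variable {α : Type*} [LinearOrder α]

theorem le_of_lt_adj {G H : SimpleGraph α} (h : ∀ ⦃u v⦄, u < v → G.Adj u v → H.Adj u v) :
    G ≤ H := by
  intro u v huv
  rcases huv.ne.lt_or_gt with hlt | hlt
  · exact h hlt huv
  · exact (h hlt huv.symm).symm

/-- When the vertices of `G` are placed on a circle in their linear order, no two edges cross. -/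
def Noncrossing (G : SimpleGraph α) : Prop :=
  ∀ ⦃a b c d : α⦄, a < b → b < c → c < d → G.Adj a c → ¬ G.Adj b d

theorem Noncrossing.mono {G H : SimpleGraph α} (hH : Noncrossing H) (hGH : G ≤ H) :
    Noncrossing G :=
  fun _ _ _ _ hab hbc hcd hac hbd => hH hab hbc hcd (hGH hac) (hGH hbd)

theorem Noncrossing.mem_uIoo {G : SimpleGraph α} (hG : Noncrossing G) {u v x y : α}
    (huv : G.Adj u v) (hxy : G.Adj x y) (hx : x ∈ Set.uIoo u v) (hyu : y ≠ u) (hyv : y ≠ v) :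
    y ∈ Set.uIoo u v := by
  wlog hlt : u < v generalizing u v
  · rw [Set.uIoo_comm]
    exact this huv.symm (by rwa [Set.uIoo_comm]) hyv hyu (huv.ne.lt_or_gt.resolve_left hlt)
  rw [Set.uIoo_of_lt hlt] at hx ⊢
  refine ⟨hyu.symm.lt_of_le (le_of_not_gt fun hy => ?_), hyv.lt_of_le (le_of_not_gt fun hy => ?_)⟩
  · exact hG hy hx.1 hx.2 hxy.symm huv
  · exact hG hx.1 hx.2 hy huv hxy

/-- The sides of the convex polygon with vertex set `S`, where the vertices are placed on a circle
in their linear order. Two vertices span a side if one of the two arcs between them contains no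
further vertex. -/
def polygon (S : Finset α) : SimpleGraph α where
  Adj u v := u ∈ S ∧ v ∈ S ∧ u ≠ v ∧
    ((∀ x ∈ S, x ∉ Set.uIoo u v) ∨ ∀ x ∈ S, x ∈ Set.uIcc u v)
  symm := ⟨fun u v ⟨hu, hv, hne, h⟩ =>
    ⟨hv, hu, hne.symm, by rwa [Set.uIoo_comm, Set.uIcc_comm]⟩⟩
  loopless := ⟨fun _ h => h.2.2.1 rfl⟩

theorem polygon_adj_of_lt {S : Finset α} {u v : α} (h : u < v) : (polygon S).Adj u v ↔
    u ∈ S ∧ v ∈ S ∧ ((∀ x ∈ S, ¬ (u < x ∧ x < v)) ∨ ∀ x ∈ S, u ≤ x ∧ x ≤ v) := by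
  simp [polygon, h.ne, Set.uIoo_of_lt h, Set.uIcc_of_lt h]

theorem polygon_le_of_consecutive {G : SimpleGraph α} {S : Finset α} {i j : α} (hi : i ∈ S)
    (hj : j ∈ S) (hS : ∀ x ∈ S, i ≤ x ∧ x ≤ j) (hij : G.Adj i j)
    (h : ∀ u ∈ S, ∀ v ∈ S, u < v → (∀ x ∈ S, ¬ (u < x ∧ x < v)) → G.Adj u v) :
    polygon S ≤ G := by
  refine le_of_lt_adj fun u v huv hadj => ?_
  obtain ⟨hu, hv, hcons | hends⟩ := (polygon_adj_of_lt huv).mp hadj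
  · exact h u hu v hv huv hcons
  · rwa [(hends i hi).1.antisymm (hS u hu).1, (hS v hv).2.antisymm (hends j hj).2]

theorem exists_polygon_adj_of_notMem {S : Finset α} {x m y : α} (hx : x ∈ S) (hy : y ∈ S)
    (hxm : x < m) (hmy : m < y) (hm : m ∉ S) : ∃ u v, u < m ∧ m < v ∧ (polygon S).Adj u v ∧
      ∀ z ∈ S, ¬ (u < z ∧ z < v) := by
  obtain ⟨u, hu, hmax⟩ := (S.filter (· < m)).exists_max_image id ⟨x, by simp [hx, hxm]⟩
  obtain ⟨v, hv, hmin⟩ := (S.filter (m < ·)).exists_min_image id ⟨y, by simp [hy, hmy]⟩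
  simp only [Finset.mem_filter, id_eq] at hu hmax hv hmin
  have hcons : ∀ z ∈ S, ¬ (u < z ∧ z < v) := by
    rintro z hz ⟨huz, hzv⟩
    rcases lt_trichotomy z m with h | rfl | h
    · exact huz.not_ge (hmax z ⟨hz, h⟩)
    · exact hm hz
    · exact hzv.not_ge (hmin z ⟨hz, h⟩)
  exact ⟨u, v, hu.2, hv.2,
    (polygon_adj_of_lt (hu.2.trans hv.2)).mpr ⟨hu.1, hv.1, Or.inl hcons⟩, hcons⟩

theorem map_polygon {β : Type*} [LinearOrder β] (f : α ↪o β) (S : Finset α) :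
    (polygon S).map f = polygon (S.map f.toEmbedding) := by
  have hIoo (x a b : α) : f x ∈ Set.uIoo (f a) (f b) ↔ x ∈ Set.uIoo a b := by
    simp only [Set.uIoo, Set.mem_Ioo, ← f.monotone.map_inf, ← f.monotone.map_sup, f.lt_iff_lt]
  have hIcc (x a b : α) : f x ∈ Set.uIcc (f a) (f b) ↔ x ∈ Set.uIcc a b := by
    simp only [Set.uIcc, Set.mem_Icc, ← f.monotone.map_inf, ← f.monotone.map_sup, f.le_iff_le]
  have hadj (a b : α) : (polygon (S.map f.toEmbedding)).Adj (f a) (f b) ↔ (polygon S).Adj a b := by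
    simp [polygon, hIoo, hIcc]
  ext u v
  constructor
  · rintro ⟨-, a, b, hab, rfl, rfl⟩
    exact (hadj a b).mpr hab
  · intro h
    obtain ⟨a, -, rfl⟩ := Finset.mem_map.mp h.1
    obtain ⟨b, -, rfl⟩ := Finset.mem_map.mp h.2.1
    exact ⟨h.ne, a, b, (hadj a b).mp h, rfl, rfl⟩

theorem cycleGraph_eq_polygon (k : ℕ) : cycleGraph k = polygon (Finset.univ : Finset (Fin k)) := by
  suffices h : ∀ u v : Fin k, u < v → ((cycleGraph k).Adj u v ↔ (polygon Finset.univ).Adj u v) by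
    ext u v
    rcases lt_trichotomy u v with huv | rfl | hvu
    · exact h u v huv
    · simp
    · rw [adj_comm, h v u hvu, adj_comm]
  intro u v huv
  rw [cycleGraph_adj_of_lt huv, polygon_adj_of_lt huv]
  simp only [Finset.mem_univ, true_and, true_imp_iff, Fin.lt_def, Fin.le_def, Fin.forall_iff]
    at huv ⊢
  constructor
  · rintro (h | h)
    · left; omega
    · right; omega
  · rintro (h | h)
    · have := h (u + 1) (by omega)
      omega
    · have h0 := h 0 (by omega)
      have h1 := h (k - 1) (by omega)
      omega

theorem map_cycleGraph_orderEmbOfFin {k : ℕ} {S : Finset α} (h : S.card = k) :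
    (cycleGraph k).map (S.orderEmbOfFin h) = polygon S := by
  rw [cycleGraph_eq_polygon, map_polygon, Finset.map_orderEmbOfFin_univ]

theorem Noncrossing.mem_uIoo_of_map_cycleGraph {k : ℕ} {f : Fin k ↪ α}
    (h : Noncrossing ((cycleGraph k).map f)) {i j a b : Fin k} (hij : (cycleGraph k).Adj i j)
    (ha : f a ∈ Set.uIoo (f i) (f j)) (hbi : b ≠ i) (hbj : b ≠ j) :
    f b ∈ Set.uIoo (f i) (f j) := by
  have hadj {c d : Fin k} (hcd : (cycleGraph k).Adj c d) :
      ((cycleGraph k).map f).Adj (f c) (f d) :=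
    ⟨f.injective.ne hcd.ne, c, d, hcd, rfl, rfl⟩
  have ha' : a ∈ ({i, j} : Set (Fin k))ᶜ := by
    rintro (rfl | rfl)
    · exact Set.left_notMem_uIoo ha
    · exact Set.right_notMem_uIoo ha
  have hb' : b ∈ ({i, j} : Set (Fin k))ᶜ := not_or.mpr ⟨hbi, hbj⟩
  have hreach := preconnected_induce_compl_cycleGraph hij ⟨a, ha'⟩ ⟨b, hb'⟩
  rw [reachable_iff_reflTransGen] at hreach
  suffices hpath : ∀ c : ({i, j} : Set (Fin k))ᶜ.Elem,
      Relation.ReflTransGen ((cycleGraph k).induce {i, j}ᶜ).Adj ⟨a, ha'⟩ c →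
      f c ∈ Set.uIoo (f i) (f j) from hpath _ hreach
  intro c hc
  induction hc with
  | refl => exact ha
  | @tail c d _ hcd ih =>
    exact h.mem_uIoo (hadj hij) (hadj hcd) ih (f.injective.ne fun hd => d.2 (Or.inl hd))
      (f.injective.ne fun hd => d.2 (Or.inr hd))

theorem Noncrossing.map_cycleGraph_eq_polygon {k : ℕ} {f : Fin k ↪ α}
    (h : Noncrossing ((cycleGraph k).map f)) :
    (cycleGraph k).map f = polygon (Finset.univ.map f) := by
  have hle : (cycleGraph k).map f ≤ polygon (Finset.univ.map f) := by
    rintro _ _ ⟨hne, i, j, hij, rfl, rfl⟩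
    refine ⟨by simp, by simp, hne, ?_⟩
    simp only [Finset.mem_map, Finset.mem_univ, true_and, forall_exists_index,
      forall_apply_eq_imp_iff]
    by_contra! hcon
    obtain ⟨⟨a, ha⟩, b, hb⟩ := hcon
    have hbi : b ≠ i := by
      rintro rfl
      exact hb Set.left_mem_uIcc
    have hbj : b ≠ j := by
      rintro rfl
      exact hb Set.right_mem_uIcc
    exact hb (Set.uIoo_subset_uIcc_self (h.mem_uIoo_of_map_cycleGraph hij ha hbi hbj))
  have hcard : (Finset.univ.map f).card = k := by simp
  rw [← map_cycleGraph_orderEmbOfFin hcard] at hle ⊢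
  exact map_eq_map_of_le (g := ((Finset.univ.map f).orderEmbOfFin hcard).toEmbedding) hle

theorem map_copy_le {V W : Type*} {G : SimpleGraph V} {H : SimpleGraph W} (f : Copy H G) :
    H.map f.toEmbedding ≤ G :=
  (map_le_iff_le_comap _ _ _).mpr f.toHom.le_comap

theorem verts_toSubgraph {V W : Type*} [Fintype W] {G : SimpleGraph V} {H : SimpleGraph W}
    (f : Copy H G) : f.toSubgraph.verts = (Finset.univ.map f.toEmbedding : Finset V) := by
  simp only [Copy.toSubgraph, Subgraph.map_verts, Subgraph.verts_top, Finset.coe_map,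
    Finset.coe_univ]
  rfl

theorem Noncrossing.toSubgraph_eq_of_verts_eq {G : SimpleGraph α} (hG : Noncrossing G) {k : ℕ}
    {f g : Copy (cycleGraph k) G} (h : f.toSubgraph.verts = g.toSubgraph.verts) :
    f.toSubgraph = g.toSubgraph := by
  have hadj (f : Copy (cycleGraph k) G) (u v : α) :
      f.toSubgraph.Adj u v ↔ (polygon (Finset.univ.map f.toEmbedding)).Adj u v := by
    rw [← (hG.mono (map_copy_le f)).map_cycleGraph_eq_polygon]
    exact ⟨fun h => ⟨h.ne, h⟩, fun h => h.2⟩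
  refine Subgraph.ext h ?_
  ext u v
  rw [verts_toSubgraph, verts_toSubgraph, Finset.coe_inj] at h
  rw [hadj, hadj, h]

theorem exists_copy_of_polygon_le {G : SimpleGraph α} {S : Finset α} (h : polygon S ≤ G) :
    ∃ f : Copy (cycleGraph S.card) G, Finset.univ.map f.toEmbedding = S := by
  rw [← map_cycleGraph_orderEmbOfFin rfl] at h
  have hcomap := (map_le_iff_le_comap (S.orderEmbOfFin rfl).toEmbedding _ _).mp h
  exact ⟨⟨⟨S.orderEmbOfFin rfl, (hcomap ·)⟩, (S.orderEmbOfFin rfl).injective⟩,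
    Finset.map_orderEmbOfFin_univ S rfl⟩

open Classical in
theorem Noncrossing.numCycles_eq_card [Fintype α] {G : SimpleGraph α} (hG : Noncrossing G)
    (k : ℕ) : numCycles G k = Finset.card {S : Finset α | S.card = k ∧ polygon S ≤ G} := by
  rw [numCycles, copyCount_eq_card_image_copyToSubgraph]
  have hvertices (f : Copy (cycleGraph k) G) :
      f.toSubgraph.verts.toFinset = Finset.univ.map f.toEmbedding :=
    Finset.coe_injective (by rw [Set.coe_toFinset, verts_toSubgraph])
  refine Finset.card_nbij (fun H => H.verts.toFinset) ?_ ?_ ?_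
  · intro H hH
    obtain ⟨f, -, rfl⟩ := Finset.mem_image.mp hH
    beta_reduce
    rw [hvertices, Finset.mem_coe, Finset.mem_filter,
      ← (hG.mono (map_copy_le f)).map_cycleGraph_eq_polygon]
    exact ⟨Finset.mem_univ _, by simp, map_copy_le f⟩
  · intro H hH H' hH' h
    obtain ⟨f, -, rfl⟩ := Finset.mem_image.mp hH
    obtain ⟨g, -, rfl⟩ := Finset.mem_image.mp hH'
    exact hG.toSubgraph_eq_of_verts_eq (Set.toFinset_inj.mp h)
  · intro S hS
    obtain ⟨rfl, hle⟩ := (Finset.mem_filter.mp hS).2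
    obtain ⟨f, hf⟩ := exists_copy_of_polygon_le hle
    exact ⟨f.toSubgraph, Finset.mem_image_of_mem _ (Finset.mem_univ f), (hvertices f).trans hf⟩

end ConvexPolygons

section Trees

open SimpleGraph BinaryTree

/-- The triangulation, of the convex polygon with the vertices `i, …, i + t.numLeaves`, that belongs
to a binary tree `t`: the root of `t` is the triangle on the base edge `i, i + t.numLeaves`, and the
two subtrees triangulate the polygons that this triangle cuts off. -/
def treeGraph : BinaryTree Unit → ℕ → SimpleGraph ℕ
  | nil, i => edge i (i + 1)
  | node _ a b, i =>
    edge i (i + a.numLeaves + b.numLeaves) ⊔ (treeGraph a i ⊔ treeGraph b (i + a.numLeaves))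

variable {t a b : BinaryTree Unit} {i u v : ℕ}

theorem treeGraph_nil_adj (huv : u < v) : (treeGraph nil i).Adj u v ↔ u = i ∧ v = i + 1 := by
  rw [treeGraph, edge_adj]
  omega

theorem treeGraph_node_adj (huv : u < v) : (treeGraph (a △ b) i).Adj u v ↔
    (u = i ∧ v = i + a.numLeaves + b.numLeaves) ∨
      (treeGraph a i).Adj u v ∨ (treeGraph b (i + a.numLeaves)).Adj u v := by
  rw [treeGraph, sup_adj, sup_adj, edge_adj]
  refine or_congr_left ?_
  omega

theorem treeGraph_left_le : treeGraph a i ≤ treeGraph (a △ b) i :=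
  le_sup_left.trans le_sup_right

theorem treeGraph_right_le : treeGraph b (i + a.numLeaves) ≤ treeGraph (a △ b) i :=
  le_sup_right.trans le_sup_right

theorem bounds_of_treeGraph_adj (huv : u < v) (h : (treeGraph t i).Adj u v) :
    i ≤ u ∧ v ≤ i + t.numLeaves := by
  induction t generalizing i with
  | nil =>
    rw [treeGraph_nil_adj huv] at h
    rw [numLeaves]
    omega
  | node _ a b ha hb =>
    rw [numLeaves]
    rcases (treeGraph_node_adj huv).mp h with h | h | h
    · omega
    · have := ha h
      omega
    · have := hb h
      omega

theorem mem_Icc_of_treeGraph_adj (h : (treeGraph t i).Adj u v) :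
    u ∈ Set.Icc i (i + t.numLeaves) := by
  rcases h.ne.lt_or_gt with huv | hvu
  · have := bounds_of_treeGraph_adj huv h
    exact ⟨by omega, by omega⟩
  · have := bounds_of_treeGraph_adj hvu h.symm
    exact ⟨by omega, by omega⟩

theorem treeGraph_adj_base (t : BinaryTree Unit) (i : ℕ) :
    (treeGraph t i).Adj i (i + t.numLeaves) := by
  have := t.numLeaves_pos
  cases t with
  | nil => exact (treeGraph_nil_adj (by omega)).mpr ⟨rfl, rfl⟩
  | node _ a b => exact (treeGraph_node_adj (by omega)).mpr (Or.inl ⟨rfl, (add_assoc _ _ _).symm⟩)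

theorem treeGraph_adj_side (hu : i ≤ u) (hu' : u < i + t.numLeaves) :
    (treeGraph t i).Adj u (u + 1) := by
  induction t generalizing i with
  | nil =>
    rw [numLeaves] at hu'
    exact (treeGraph_nil_adj (by omega)).mpr (by omega)
  | node _ a b ha hb =>
    rw [numLeaves] at hu'
    rcases lt_or_ge u (i + a.numLeaves) with h | h
    · exact treeGraph_left_le (ha hu h)
    · exact treeGraph_right_le (hb h (by omega))

theorem treeGraph_left_adj (huv : u < v) (hv : v ≤ i + a.numLeaves) :
    (treeGraph a i).Adj u v ↔ (treeGraph (a △ b) i).Adj u v := by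
  refine ⟨(treeGraph_left_le ·), fun h => ?_⟩
  have := b.numLeaves_pos
  rcases (treeGraph_node_adj huv).mp h with h | h | h
  · omega
  · exact h
  · have := bounds_of_treeGraph_adj huv h
    omega

theorem treeGraph_right_adj (huv : u < v) (hu : i + a.numLeaves ≤ u) :
    (treeGraph b (i + a.numLeaves)).Adj u v ↔ (treeGraph (a △ b) i).Adj u v := by
  refine ⟨(treeGraph_right_le ·), fun h => ?_⟩
  have := a.numLeaves_pos
  rcases (treeGraph_node_adj huv).mp h with h | h | h
  · omega
  · have := bounds_of_treeGraph_adj huv h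
    omega
  · exact h

theorem eq_base_of_treeGraph_adj (hu : u < i + a.numLeaves) (hv : i + a.numLeaves < v)
    (h : (treeGraph (a △ b) i).Adj u v) : u = i ∧ v = i + a.numLeaves + b.numLeaves := by
  rcases (treeGraph_node_adj (hu.trans hv)).mp h with h | h | h
  · exact h
  · have := bounds_of_treeGraph_adj (hu.trans hv) h
    omega
  · have := bounds_of_treeGraph_adj (hu.trans hv) h
    omega

theorem noncrossing_treeGraph (t : BinaryTree Unit) (i : ℕ) : Noncrossing (treeGraph t i) := by
  induction t generalizing i with
  | nil =>
    intro u x v y hux hxv _ huv hxy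
    rw [treeGraph_nil_adj (by omega)] at huv hxy
    omega
  | node _ a b ha hb =>
    intro u x v y hux hxv hvy huv hxy
    have hu := bounds_of_treeGraph_adj (by omega) huv
    have hy := bounds_of_treeGraph_adj (by omega) hxy
    rw [numLeaves] at hu hy
    rcases le_or_gt y (i + a.numLeaves) with hym | hmy
    · exact ha i hux hxv hvy ((treeGraph_left_adj (by omega) (by omega)).mpr huv)
        ((treeGraph_left_adj (by omega) hym).mpr hxy)
    rcases lt_or_ge x (i + a.numLeaves) with hxm | hmx
    · have := eq_base_of_treeGraph_adj hxm hmy hxy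
      omega
    rcases lt_or_ge u (i + a.numLeaves) with hum | hmu
    · have := eq_base_of_treeGraph_adj hum (by omega) huv
      omega
    · exact hb _ hux hxv hvy ((treeGraph_right_adj (by omega) hmu).mpr huv)
        ((treeGraph_right_adj (by omega) hmx).mpr hxy)

theorem encard_edgeSet_treeGraph (t : BinaryTree Unit) (i : ℕ) :
    (treeGraph t i).edgeSet.encard + 1 = 2 * t.numLeaves := by
  induction t generalizing i with
  | nil =>
    rw [treeGraph, edgeSet_edge_of_ne (by omega), Set.encard_singleton, numLeaves]
    norm_num
  | node _ a b ha hb =>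
    have hpa := a.numLeaves_pos
    have hpb := b.numLeaves_pos
    have hdisj : Disjoint (treeGraph a i).edgeSet (treeGraph b (i + a.numLeaves)).edgeSet := by
      rw [disjoint_edgeSet, disjoint_left]
      intro u v hu hv
      wlog huv : u < v generalizing u v
      · exact this v u hu.symm hv.symm (hu.ne.lt_or_gt.resolve_left huv)
      have := bounds_of_treeGraph_adj huv hu
      have := bounds_of_treeGraph_adj huv hv
      omega
    have hbase : s(i, i + a.numLeaves + b.numLeaves) ∉
        (treeGraph a i).edgeSet ∪ (treeGraph b (i + a.numLeaves)).edgeSet := by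
      rintro (h | h)
      · have := bounds_of_treeGraph_adj (by omega) h
        omega
      · have := bounds_of_treeGraph_adj (by omega) h
        omega
    rw [treeGraph, edgeSet_sup, edgeSet_sup, edgeSet_edge_of_ne (by omega),
      Set.singleton_union, Set.encard_insert_of_notMem hbase, Set.encard_union_eq hdisj, numLeaves,
      Nat.cast_add, mul_add, ← ha i, ← hb (i + a.numLeaves)]
    ring

theorem eq_of_treeGraph_le {t t' : BinaryTree Unit} {i : ℕ} (hw : t.numLeaves = t'.numLeaves)
    (h : treeGraph t i ≤ treeGraph t' i) : t = t' := by
  induction t generalizing t' i with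
  | nil =>
    cases t' with
    | nil => rfl
    | node _ a b =>
      have := a.numLeaves_pos
      have := b.numLeaves_pos
      simp only [numLeaves] at hw
      omega
  | node _ a b ha hb =>
    have hpa := a.numLeaves_pos
    have hpb := b.numLeaves_pos
    cases t' with
    | nil =>
      simp only [numLeaves] at hw
      omega
    | node _ a' b' =>
      have := a'.numLeaves_pos
      have := b'.numLeaves_pos
      simp only [numLeaves] at hw
      have hm : a.numLeaves = a'.numLeaves := by
        refine le_antisymm (le_of_not_gt fun hlt => ?_) (le_of_not_gt fun hlt => ?_)
        · have := eq_base_of_treeGraph_adj (by omega) (by omega)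
            (h (treeGraph_left_le (treeGraph_adj_base a i)))
          omega
        · have := eq_base_of_treeGraph_adj (by omega) (by omega)
            (h (treeGraph_right_le (treeGraph_adj_base b _)))
          omega
      obtain rfl : a = a' := by
        refine ha (i := i) hm (le_of_lt_adj fun u v huv hadj => ?_)
        have := bounds_of_treeGraph_adj huv hadj
        exact (treeGraph_left_adj huv (by omega)).mpr (h (treeGraph_left_le hadj))
      obtain rfl : b = b' := by
        refine hb (i := i + a.numLeaves) (by omega) (le_of_lt_adj fun u v huv hadj => ?_)
        have := bounds_of_treeGraph_adj huv hadj
        exact (treeGraph_right_adj huv this.1).mpr (h (treeGraph_right_le hadj))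
      rfl

end Trees

section Triangulations

open SimpleGraph BinaryTree

theorem Noncrossing.exists_apex {G : SimpleGraph ℕ} (hG : Noncrossing G) {i j : ℕ}
    (hij : i + 1 < j) : ∃ m, i < m ∧ m < j ∧
      ∀ u v, i ≤ u → u < m → m < v → v ≤ j → G.Adj u v → u = i ∧ v = j := by
  classical
  -- The apex is the largest neighbour of `i` below `j`.
  obtain ⟨m, hm, hmax⟩ := Finset.exists_max_image
    {y ∈ Finset.Ioo i j | y = i + 1 ∨ G.Adj i y} id
    ⟨i + 1, Finset.mem_filter.mpr ⟨Finset.mem_Ioo.mpr ⟨by omega, hij⟩, Or.inl rfl⟩⟩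
  simp only [Finset.mem_filter, Finset.mem_Ioo, id_eq] at hm hmax
  obtain ⟨⟨him, hmj⟩, hadj⟩ := hm
  refine ⟨m, him, hmj, fun u v hu hum hmv hv huv => ?_⟩
  obtain rfl : u = i := by
    rcases hadj with rfl | hadj
    · omega
    · exact hu.antisymm' (le_of_not_gt fun hiu => hG hiu hum hmv hadj huv)
  refine ⟨rfl, hv.antisymm (le_of_not_gt fun hvj => ?_)⟩
  exact absurd (hmax v ⟨⟨by omega, hvj⟩, Or.inr huv⟩) (by omega)

theorem Noncrossing.exists_treeGraph_adj {G : SimpleGraph ℕ} (hG : Noncrossing G) {w : ℕ}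
    (hw : 1 ≤ w) (i : ℕ) : ∃ t : BinaryTree Unit, t.numLeaves = w ∧
      ∀ u v, i ≤ u → u < v → v ≤ i + w → G.Adj u v → (treeGraph t i).Adj u v := by
  induction w using Nat.strong_induction_on generalizing i with
  | _ w ih =>
  obtain rfl | hw := hw.eq_or_lt
  · exact ⟨nil, rfl, fun u v hu huv hv _ => (treeGraph_nil_adj huv).mpr (by omega)⟩
  obtain ⟨m, him, hmj, hapex⟩ := hG.exists_apex (i := i) (j := i + w) (by omega)
  obtain ⟨a, ha, hleft⟩ := ih (m - i) (by omega) (by omega) i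
  obtain ⟨b, hb, hright⟩ := ih (i + w - m) (by omega) (by omega) m
  obtain rfl : m = i + a.numLeaves := by omega
  refine ⟨a △ b, by rw [numLeaves]; omega, fun u v hu huv hv hadj => ?_⟩
  rcases le_or_gt v (i + a.numLeaves) with hvm | hmv
  · exact treeGraph_left_le (hleft u v hu huv (by omega) hadj)
  rcases le_or_gt (i + a.numLeaves) u with hmu | hum
  · exact treeGraph_right_le (hright u v hmu huv (by omega) hadj)
  · have := hapex u v hu hum hmv hv hadj
    exact (treeGraph_node_adj huv).mpr (Or.inl (by omega))

variable {n : ℕ}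

section Graph

variable {D : Finset (Sym2 (Fin n))}

theorem edgeSet_graph (hD : ∀ e ∈ D, IsDiagonal e) :
    (graph D).edgeSet = (cycleGraph n).edgeSet ∪ D := by
  rw [graph, edgeSet_sup, edgeSet_fromEdgeSet, sdiff_eq_left.mpr]
  exact Set.disjoint_left.mpr fun e he => (hD e he).1

theorem edgeSet_graph_sdiff (hD : ∀ e ∈ D, IsDiagonal e) :
    (graph D).edgeSet \ (cycleGraph n).edgeSet = D := by
  rw [edgeSet_graph hD, Set.union_sdiff_cancel_left]
  exact fun e he => (hD e he.2).2 he.1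

theorem exists_graph_eq {G : SimpleGraph (Fin n)} (hG : cycleGraph n ≤ G) :
    ∃ D : Finset (Sym2 (Fin n)), (∀ e ∈ D, IsDiagonal e) ∧ graph D = G := by
  classical
  let D := (G.edgeSet \ (cycleGraph n).edgeSet).toFinset
  have hD : ∀ e ∈ D, IsDiagonal e := fun e he =>
    have he := Set.mem_toFinset.mp he
    ⟨G.not_isDiag_of_mem_edgeSet he.1, he.2⟩
  refine ⟨D, hD, edgeSet_inj.mp ?_⟩
  rw [edgeSet_graph hD, Set.coe_toFinset, Set.union_sdiff_cancel (edgeSet_mono hG)]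

theorem noncrossing_graph_iff :
    Noncrossing (graph D) ↔ ∀ e ∈ D, ∀ f ∈ D, ¬ Cross e f := by
  have hmem {u v : Fin n} (huv : u < v) (h : s(u, v) ∈ D) : (graph D).Adj u v :=
    Or.inr ((fromEdgeSet_adj _).mpr ⟨h, huv.ne⟩)
  constructor
  · rintro hG e he f hf ⟨a, b, c, d, hab, hbc, hcd, ⟨rfl, rfl⟩ | ⟨rfl, rfl⟩⟩
    · exact hG hab hbc hcd (hmem (hab.trans hbc) he) (hmem (hbc.trans hcd) hf)
    · exact hG hab hbc hcd (hmem (hab.trans hbc) hf) (hmem (hbc.trans hcd) he)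
  · intro hD a b c d hab hbc hcd hac hbd
    simp only [graph, sup_adj, fromEdgeSet_adj, cycleGraph_adj_of_lt (hab.trans hbc),
      cycleGraph_adj_of_lt (hbc.trans hcd)] at hac hbd
    rw [Fin.lt_def] at hab hbc hcd
    exact hD _ (hac.resolve_left (by omega)).1 _ (hbd.resolve_left (by omega)).1
      ⟨a, b, c, d, hab, hbc, hcd, Or.inl ⟨rfl, rfl⟩⟩

theorem encard_edgeSet_cycleGraph (hn : 3 ≤ n) : (cycleGraph n).edgeSet.encard = n := by
  obtain ⟨m, rfl⟩ : ∃ m, n = m + 3 := ⟨n - 3, by omega⟩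
  have h := (cycleGraph (m + 3)).sum_degrees_eq_twice_card_edges
  simp only [cycleGraph_degree_three_le, Finset.sum_const, Finset.card_univ, Fintype.card_fin,
    smul_eq_mul] at h
  rw [← coe_edgeFinset, Set.encard_coe_eq_coe_finsetCard]
  norm_cast
  omega

theorem isTriangulation_iff (hn : 3 ≤ n) (hD : ∀ e ∈ D, IsDiagonal e) : IsTriangulation D ↔
    Noncrossing (graph D) ∧ (graph D).edgeSet.encard + 3 = 2 * n := by
  have hcard : (graph D).edgeSet.encard = n + D.card := by
    rw [edgeSet_graph hD, Set.encard_union_eq, encard_edgeSet_cycleGraph hn,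
      Set.encard_coe_eq_coe_finsetCard]
    exact Set.disjoint_right.mpr fun e he => (hD e he).2
  have hiff : (n + D.card : ℕ∞) + 3 = 2 * n ↔ D.card = n - 3 := by
    norm_cast
    omega
  rw [IsTriangulation, IsDissection, noncrossing_graph_iff, hcard, hiff]
  tauto

end Graph

/-- The graph `treeGraph t 0`, seen as a graph on the vertices of the `n`-gon; this is meant for
trees `t` with `n - 1` leaves. -/
def treeTriangulation (n : ℕ) (t : BinaryTree Unit) : SimpleGraph (Fin n) :=
  (treeGraph t 0).comap Fin.val

theorem noncrossing_treeTriangulation (n : ℕ) (t : BinaryTree Unit) :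
    Noncrossing (treeTriangulation n t) :=
  fun _ _ _ _ hab hbc hcd hac hbd => noncrossing_treeGraph t 0 hab hbc hcd hac hbd

variable {t : BinaryTree Unit}

theorem cycleGraph_le_treeTriangulation (ht : t.numLeaves + 1 = n) :
    cycleGraph n ≤ treeTriangulation n t := by
  refine le_of_lt_adj fun u v huv h => ?_
  rw [treeTriangulation, comap_adj]
  rcases (cycleGraph_adj_of_lt huv).mp h with hv | ⟨hu, hv⟩
  · rw [hv]
    exact treeGraph_adj_side (by omega) (by omega)
  · have := treeGraph_adj_base t 0
    rwa [hu, show v.val = 0 + t.numLeaves by omega]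

theorem map_treeTriangulation (ht : t.numLeaves + 1 = n) :
    (treeTriangulation n t).map Fin.valEmbedding = treeGraph t 0 := by
  refine le_antisymm ((map_le_iff_le_comap _ _ _).mpr le_rfl) fun u v h => ?_
  have hu := (mem_Icc_of_treeGraph_adj h).2
  have hv := (mem_Icc_of_treeGraph_adj h.symm).2
  exact ⟨h.ne, ⟨u, by omega⟩, ⟨v, by omega⟩, h, rfl, rfl⟩

theorem encard_edgeSet_treeTriangulation (ht : t.numLeaves + 1 = n) :
    (treeTriangulation n t).edgeSet.encard + 3 = 2 * n := by
  subst ht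
  have h := encard_edgeSet_treeGraph t 0
  rw [← map_treeTriangulation rfl, edgeSet_map, (Function.Embedding.injective _).encard_image] at h
  rw [Nat.cast_add, mul_add, ← h]
  norm_num
  ring

theorem eq_of_treeTriangulation_eq {t' : BinaryTree Unit} (ht : t.numLeaves + 1 = n)
    (ht' : t'.numLeaves + 1 = n) (h : treeTriangulation n t = treeTriangulation n t') :
    t = t' := by
  refine eq_of_treeGraph_le (i := 0) (by omega) ?_
  rw [← map_treeTriangulation ht, ← map_treeTriangulation ht', h]

theorem Noncrossing.exists_le_treeTriangulation {G : SimpleGraph (Fin n)} (hG : Noncrossing G)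
    (hn : 2 ≤ n) : ∃ t : BinaryTree Unit, t.numLeaves + 1 = n ∧ G ≤ treeTriangulation n t := by
  have hmap : Noncrossing (G.map Fin.valEmbedding) := by
    rintro _ _ _ _ hab hbc hcd ⟨-, a, c, hac, rfl, rfl⟩ ⟨-, b, d, hbd, rfl, rfl⟩
    exact hG hab hbc hcd hac hbd
  obtain ⟨t, ht, hadj⟩ := hmap.exists_treeGraph_adj (w := n - 1) (by omega) 0
  refine ⟨t, by omega, le_of_lt_adj fun u v huv h => ?_⟩
  exact hadj u v (Nat.zero_le _) huv (by omega) ⟨Fin.val_ne_of_ne h.ne, u, v, h, rfl, rfl⟩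

open Classical in
theorem image_graph_triangulations (hn : 3 ≤ n) : (triangulations n).image graph =
    (treesOfNumNodesEq (n - 2)).image (treeTriangulation n) := by
  have hleaves (t : BinaryTree Unit) : t.numNodes = n - 2 ↔ t.numLeaves + 1 = n := by
    rw [numLeaves_eq_numNodes_succ]
    omega
  ext G
  simp only [triangulations, Finset.mem_image, Finset.mem_filter, Finset.mem_univ, true_and,
    mem_treesOfNumNodesEq, hleaves]
  constructor
  · rintro ⟨D, hD, rfl⟩
    obtain ⟨hcross, hcard⟩ := (isTriangulation_iff hn hD.2.1).mp hD
    obtain ⟨t, ht, hle⟩ := hcross.exists_le_treeTriangulation (by omega)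
    refine ⟨t, ht, edgeSet_inj.mp ((Set.toFinite _).eq_of_subset_of_encard_le
      (edgeSet_mono hle) ?_).symm⟩
    rw [← encard_edgeSet_treeTriangulation ht] at hcard
    exact (WithTop.add_right_cancel (by decide) hcard).ge
  · rintro ⟨t, ht, rfl⟩
    obtain ⟨D, hD, heq⟩ := exists_graph_eq (cycleGraph_le_treeTriangulation ht)
    refine ⟨D, (isTriangulation_iff hn hD).mpr ?_, heq⟩
    rw [heq]
    exact ⟨noncrossing_treeTriangulation n t, encard_edgeSet_treeTriangulation ht⟩

theorem sum_triangulations {M : Type*} [AddCommMonoid M] (hn : 3 ≤ n)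
    (F : SimpleGraph (Fin n) → M) : ∑ D ∈ triangulations n, F (graph D) =
      ∑ t ∈ treesOfNumNodesEq (n - 2), F (treeTriangulation n t) := by
  classical
  have hleaves {t : BinaryTree Unit} (ht : t ∈ treesOfNumNodesEq (n - 2)) :
      t.numLeaves + 1 = n := by
    rw [numLeaves_eq_numNodes_succ, mem_treesOfNumNodesEq.mp ht]
    omega
  have hdiag {D : Finset (Sym2 (Fin n))} (hD : D ∈ triangulations n) : ∀ e ∈ D, IsDiagonal e :=
    (Finset.mem_filter.mp hD).2.2.1
  rw [← Finset.sum_image (f := F) (g := graph), image_graph_triangulations hn, Finset.sum_image]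
  · exact fun t ht t' ht' h => eq_of_treeTriangulation_eq (hleaves ht) (hleaves ht') h
  · intro D hD D' hD' h
    rw [← Finset.coe_inj, ← edgeSet_graph_sdiff (hdiag hD), h, edgeSet_graph_sdiff (hdiag hD')]

theorem card_triangulations (hn : 3 ≤ n) : (triangulations n).card = catalan (n - 2) := by
  have h := sum_triangulations hn fun _ => 1
  rwa [Finset.sum_const, Finset.sum_const, smul_eq_mul, smul_eq_mul, mul_one, mul_one,
    treesOfNumNodesEq_card_eq_catalan] at h

end Triangulations

section CountingCycles

open Finset BinaryTree

open Classical in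
/-- The vertex sets of the paths in `treeGraph t i` that join the end points of the base edge and
follow the order of the vertices. Closing such a path by the base edge gives a convex polygon,
which is degenerate if the path is the base edge itself. -/
noncomputable def pathSets (t : BinaryTree Unit) (i : ℕ) : Finset (Finset ℕ) :=
  {S ∈ (Icc i (i + t.numLeaves)).powerset |
    i ∈ S ∧ i + t.numLeaves ∈ S ∧ polygon S ≤ treeGraph t i}

open Classical in
/-- The vertex sets of the cycles in `treeGraph t i`, that is, of the convex polygons all of whose
sides are edges of this graph. -/
noncomputable def cycleSets (t : BinaryTree Unit) (i : ℕ) : Finset (Finset ℕ) :=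
  {S ∈ (Icc i (i + t.numLeaves)).powerset | 3 ≤ #S ∧ polygon S ≤ treeGraph t i}

variable {t a b : BinaryTree Unit} {i : ℕ} {S S₁ S₂ : Finset ℕ}

theorem mem_pathSets : S ∈ pathSets t i ↔ (∀ x ∈ S, i ≤ x ∧ x ≤ i + t.numLeaves) ∧
    i ∈ S ∧ i + t.numLeaves ∈ S ∧ polygon S ≤ treeGraph t i := by
  simp [pathSets, subset_iff]

theorem mem_cycleSets : S ∈ cycleSets t i ↔ (∀ x ∈ S, i ≤ x ∧ x ≤ i + t.numLeaves) ∧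
    3 ≤ #S ∧ polygon S ≤ treeGraph t i := by
  simp [cycleSets, subset_iff]

theorem base_mem_pathSets (t : BinaryTree Unit) (i : ℕ) : {i, i + t.numLeaves} ∈ pathSets t i := by
  have hbounds : ∀ x ∈ ({i, i + t.numLeaves} : Finset ℕ), i ≤ x ∧ x ≤ i + t.numLeaves := by
    simp
  refine mem_pathSets.mpr ⟨hbounds, by simp, by simp, polygon_le_of_consecutive (by simp) (by simp)
    hbounds (treeGraph_adj_base t i) fun u hu v hv huv _ => ?_⟩
  rw [mem_insert, mem_singleton] at hu hv
  obtain ⟨rfl, rfl⟩ : u = i ∧ v = i + t.numLeaves := by omega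
  exact treeGraph_adj_base t u

theorem eq_base_of_mem_pathSets_of_notMem (hS : S ∈ pathSets (a △ b) i)
    (hm : i + a.numLeaves ∉ S) : S = {i, i + (a △ b).numLeaves} := by
  obtain ⟨hbounds, hi, hj, hle⟩ := mem_pathSets.mp hS
  have := a.numLeaves_pos
  have := b.numLeaves_pos
  rw [numLeaves] at *
  obtain ⟨u, v, hum, hmv, hadj, hcons⟩ :=
    exists_polygon_adj_of_notMem hi hj (by omega) (by omega) hm
  obtain ⟨rfl, rfl⟩ := eq_base_of_treeGraph_adj hum hmv (hle hadj)
  ext x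
  rw [mem_insert, mem_singleton]
  refine ⟨fun hx => ?_, by rintro (rfl | rfl) <;> assumption⟩
  have := hbounds x hx
  have := hcons x hx
  omega

theorem union_mem_pathSets (h₁ : S₁ ∈ pathSets a i) (h₂ : S₂ ∈ pathSets b (i + a.numLeaves)) :
    S₁ ∪ S₂ ∈ pathSets (a △ b) i := by
  obtain ⟨hbounds₁, hi, hm₁, hle₁⟩ := mem_pathSets.mp h₁
  obtain ⟨hbounds₂, hm₂, hj, hle₂⟩ := mem_pathSets.mp h₂
  have hbounds : ∀ x ∈ S₁ ∪ S₂, i ≤ x ∧ x ≤ i + (a △ b).numLeaves := by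
    intro x hx
    rw [numLeaves]
    rcases mem_union.mp hx with hx | hx
    · have := hbounds₁ x hx
      omega
    · have := hbounds₂ x hx
      omega
  have hi' := mem_union_left S₂ hi
  have hj' : i + (a △ b).numLeaves ∈ S₁ ∪ S₂ := by
    rw [numLeaves, ← add_assoc]
    exact mem_union_right S₁ hj
  refine mem_pathSets.mpr ⟨hbounds, hi', hj', polygon_le_of_consecutive hi' hj' hbounds
    (treeGraph_adj_base _ i) fun u hu v hv huv hcons => ?_⟩
  have hm := hcons _ (mem_union_left S₂ hm₁)
  have hmem₁ {x : ℕ} (hx : x ∈ S₁ ∪ S₂) (hxm : x ≤ i + a.numLeaves) : x ∈ S₁ := by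
    refine (mem_union.mp hx).elim id fun hx₂ => ?_
    rwa [hxm.antisymm (hbounds₂ x hx₂).1]
  have hmem₂ {x : ℕ} (hx : x ∈ S₁ ∪ S₂) (hmx : i + a.numLeaves ≤ x) : x ∈ S₂ := by
    refine (mem_union.mp hx).elim (fun hx₁ => ?_) id
    rwa [(hbounds₁ x hx₁).2.antisymm hmx]
  rcases le_or_gt v (i + a.numLeaves) with hvm | hmv
  · exact treeGraph_left_le (hle₁ ((polygon_adj_of_lt huv).mpr ⟨hmem₁ hu (by omega), hmem₁ hv hvm,
      Or.inl fun x hx => hcons x (mem_union_left S₂ hx)⟩))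
  · exact treeGraph_right_le (hle₂ ((polygon_adj_of_lt huv).mpr ⟨hmem₂ hu (by omega),
      hmem₂ hv hmv.le, Or.inl fun x hx => hcons x (mem_union_right S₁ hx)⟩))

theorem filter_le_mem_pathSets (hS : S ∈ pathSets (a △ b) i) (hm : i + a.numLeaves ∈ S) :
    S.filter (· ≤ i + a.numLeaves) ∈ pathSets a i := by
  obtain ⟨hbounds, hi, -, hle⟩ := mem_pathSets.mp hS
  have hbounds' : ∀ x ∈ S.filter (· ≤ i + a.numLeaves), i ≤ x ∧ x ≤ i + a.numLeaves :=
    fun x hx => ⟨(hbounds x (mem_filter.mp hx).1).1, (mem_filter.mp hx).2⟩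
  have hi' : i ∈ S.filter (· ≤ i + a.numLeaves) := mem_filter.mpr ⟨hi, Nat.le_add_right _ _⟩
  have hm' : i + a.numLeaves ∈ S.filter (· ≤ i + a.numLeaves) := mem_filter.mpr ⟨hm, le_rfl⟩
  refine mem_pathSets.mpr ⟨hbounds', hi', hm', polygon_le_of_consecutive hi' hm' hbounds'
    (treeGraph_adj_base a i) fun u hu v hv huv hcons => ?_⟩
  rw [mem_filter] at hu hv
  refine (treeGraph_left_adj huv hv.2).mpr (hle ((polygon_adj_of_lt huv).mpr
    ⟨hu.1, hv.1, Or.inl fun x hx hx' => hcons x (mem_filter.mpr ⟨hx, ?_⟩) hx'⟩))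
  omega

theorem filter_ge_mem_pathSets (hS : S ∈ pathSets (a △ b) i) (hm : i + a.numLeaves ∈ S) :
    S.filter (i + a.numLeaves ≤ ·) ∈ pathSets b (i + a.numLeaves) := by
  obtain ⟨hbounds, -, hj, hle⟩ := mem_pathSets.mp hS
  rw [numLeaves, ← add_assoc] at hbounds hj
  have hbounds' : ∀ x ∈ S.filter (i + a.numLeaves ≤ ·),
      i + a.numLeaves ≤ x ∧ x ≤ i + a.numLeaves + b.numLeaves :=
    fun x hx => ⟨(mem_filter.mp hx).2, (hbounds x (mem_filter.mp hx).1).2⟩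
  have hm' : i + a.numLeaves ∈ S.filter (i + a.numLeaves ≤ ·) := mem_filter.mpr ⟨hm, le_rfl⟩
  have hj' : i + a.numLeaves + b.numLeaves ∈ S.filter (i + a.numLeaves ≤ ·) :=
    mem_filter.mpr ⟨hj, Nat.le_add_right _ _⟩
  refine mem_pathSets.mpr ⟨hbounds', hm', hj', polygon_le_of_consecutive hm' hj' hbounds'
    (treeGraph_adj_base b _) fun u hu v hv huv hcons => ?_⟩
  rw [mem_filter] at hu hv
  refine (treeGraph_right_adj huv hu.2).mpr (hle ((polygon_adj_of_lt huv).mpr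
    ⟨hu.1, hv.1, Or.inl fun x hx hx' => hcons x (mem_filter.mpr ⟨hx, ?_⟩) hx'⟩))
  omega

theorem mem_image₂_union_pathSets :
    S ∈ image₂ (· ∪ ·) (pathSets a i) (pathSets b (i + a.numLeaves)) ↔
      S ∈ pathSets (a △ b) i ∧ i + a.numLeaves ∈ S := by
  rw [mem_image₂]
  constructor
  · rintro ⟨S₁, h₁, S₂, h₂, rfl⟩
    exact ⟨union_mem_pathSets h₁ h₂, mem_union_left S₂ (mem_pathSets.mp h₁).2.2.1⟩
  · rintro ⟨hS, hm⟩
    refine ⟨_, filter_le_mem_pathSets hS hm, _, filter_ge_mem_pathSets hS hm, ?_⟩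
    rw [← filter_or, filter_true_of_mem fun x _ => le_total x _]

theorem pathSets_nil (i : ℕ) : pathSets nil i = {{i, i + 1}} := by
  refine eq_singleton_iff_unique_mem.mpr ⟨base_mem_pathSets nil i, fun S hS => ?_⟩
  obtain ⟨hbounds, hi, hj, -⟩ := mem_pathSets.mp hS
  rw [numLeaves] at hbounds hj
  ext x
  rw [mem_insert, mem_singleton]
  refine ⟨fun hx => ?_, by rintro (rfl | rfl) <;> assumption⟩
  have := hbounds x hx
  omega

theorem pathSets_node (a b : BinaryTree Unit) (i : ℕ) : pathSets (a △ b) i =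
    insert {i, i + (a △ b).numLeaves}
      (image₂ (· ∪ ·) (pathSets a i) (pathSets b (i + a.numLeaves))) := by
  ext S
  rw [mem_insert, mem_image₂_union_pathSets]
  constructor
  · intro hS
    by_cases hm : i + a.numLeaves ∈ S
    · exact Or.inr ⟨hS, hm⟩
    · exact Or.inl (eq_base_of_mem_pathSets_of_notMem hS hm)
  · rintro (rfl | hS)
    · exact base_mem_pathSets (a △ b) i
    · exact hS.1

theorem three_le_card_of_mem_pathSets (hS : S ∈ pathSets (a △ b) i) (hm : i + a.numLeaves ∈ S) :
    3 ≤ #S := by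
  obtain ⟨-, hi, hj, -⟩ := mem_pathSets.mp hS
  have := a.numLeaves_pos
  have := b.numLeaves_pos
  rw [numLeaves] at hj
  exact two_lt_card.mpr ⟨_, hi, _, hm, _, hj, by omega, by omega, by omega⟩

theorem mem_pathSets_of_mem_cycleSets {x y : ℕ} (hS : S ∈ cycleSets (a △ b) i) (hx : x ∈ S)
    (hxm : x < i + a.numLeaves) (hy : y ∈ S) (hmy : i + a.numLeaves < y) :
    S ∈ pathSets (a △ b) i ∧ i + a.numLeaves ∈ S := by
  obtain ⟨hbounds, hcard, hle⟩ := mem_cycleSets.mp hS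
  have hne : S.Nonempty := ⟨x, hx⟩
  have hmin := (S.min'_le x hx).trans_lt hxm
  have hmax := hmy.trans_le (S.le_max' y hy)
  have hadj : (polygon S).Adj (S.min' hne) (S.max' hne) :=
    (polygon_adj_of_lt (hmin.trans hmax)).mpr ⟨S.min'_mem hne, S.max'_mem hne,
      Or.inr fun z hz => ⟨S.min'_le z hz, S.le_max' z hz⟩⟩
  obtain ⟨hi, hj⟩ := eq_base_of_treeGraph_adj hmin hmax (hle hadj)
  have hpath : S ∈ pathSets (a △ b) i := by
    refine mem_pathSets.mpr ⟨hbounds, hi ▸ S.min'_mem hne, ?_, hle⟩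
    rw [numLeaves, ← add_assoc, ← hj]
    exact S.max'_mem hne
  refine ⟨hpath, by_contra fun hm => ?_⟩
  rw [eq_base_of_mem_pathSets_of_notMem hpath hm] at hcard
  exact absurd hcard (by have := card_le_two (a := i) (b := i + (a △ b).numLeaves); omega)

theorem mem_cycleSets_left : S ∈ cycleSets a i ↔
    S ∈ cycleSets (a △ b) i ∧ ∀ x ∈ S, x ≤ i + a.numLeaves := by
  simp only [mem_cycleSets, numLeaves]
  constructor
  · rintro ⟨hbounds, hcard, hle⟩
    refine ⟨⟨fun x hx => ?_, hcard, hle.trans treeGraph_left_le⟩, fun x hx => (hbounds x hx).2⟩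
    have := hbounds x hx
    omega
  · rintro ⟨⟨hbounds, hcard, hle⟩, hm⟩
    exact ⟨fun x hx => ⟨(hbounds x hx).1, hm x hx⟩, hcard, le_of_lt_adj fun u v huv hadj =>
      (treeGraph_left_adj huv (hm v hadj.2.1)).mpr (hle hadj)⟩

theorem mem_cycleSets_right : S ∈ cycleSets b (i + a.numLeaves) ↔
    S ∈ cycleSets (a △ b) i ∧ ∀ x ∈ S, i + a.numLeaves ≤ x := by
  simp only [mem_cycleSets, numLeaves, ← add_assoc]
  constructor
  · rintro ⟨hbounds, hcard, hle⟩
    refine ⟨⟨fun x hx => ?_, hcard, hle.trans treeGraph_right_le⟩, fun x hx => (hbounds x hx).1⟩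
    have := hbounds x hx
    omega
  · rintro ⟨⟨hbounds, hcard, hle⟩, hm⟩
    exact ⟨fun x hx => ⟨hm x hx, (hbounds x hx).2⟩, hcard, le_of_lt_adj fun u v huv hadj =>
      (treeGraph_right_adj huv (hm u hadj.1)).mpr (hle hadj)⟩

theorem cycleSets_nil (i : ℕ) : cycleSets nil i = ∅ := by
  refine eq_empty_of_forall_notMem fun S hS => ?_
  obtain ⟨hbounds, hcard, -⟩ := mem_cycleSets.mp hS
  have := card_le_card fun x hx => mem_Icc.mpr (hbounds x hx)
  rw [Nat.card_Icc, numLeaves] at this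
  omega

theorem cycleSets_node (a b : BinaryTree Unit) (i : ℕ) : cycleSets (a △ b) i =
    cycleSets a i ∪ cycleSets b (i + a.numLeaves) ∪
      image₂ (· ∪ ·) (pathSets a i) (pathSets b (i + a.numLeaves)) := by
  ext S
  rw [mem_union, mem_union, mem_image₂_union_pathSets, mem_cycleSets_left (a := a) (b := b),
    mem_cycleSets_right (a := a) (b := b)]
  constructor
  · intro hS
    by_cases hleft : ∀ x ∈ S, x ≤ i + a.numLeaves
    · exact Or.inl (Or.inl ⟨hS, hleft⟩)
    by_cases hright : ∀ x ∈ S, i + a.numLeaves ≤ x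
    · exact Or.inl (Or.inr ⟨hS, hright⟩)
    push Not at hleft hright
    obtain ⟨y, hy, hmy⟩ := hleft
    obtain ⟨x, hx, hxm⟩ := hright
    exact Or.inr (mem_pathSets_of_mem_cycleSets hS hx hxm hy hmy)
  · rintro ((hS | hS) | ⟨hS, hm⟩)
    · exact hS.1
    · exact hS.1
    · obtain ⟨hbounds, -, -, hle⟩ := mem_pathSets.mp hS
      exact mem_cycleSets.mpr ⟨hbounds, three_le_card_of_mem_pathSets hS hm, hle⟩

end CountingCycles

section Weights

open Finset BinaryTree

variable {a b : BinaryTree Unit} {i : ℕ} {S₁ S₂ : Finset ℕ}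

theorem card_union_of_mem_pathSets (h₁ : S₁ ∈ pathSets a i)
    (h₂ : S₂ ∈ pathSets b (i + a.numLeaves)) : #(S₁ ∪ S₂) - 1 = (#S₁ - 1) + (#S₂ - 1) := by
  obtain ⟨hbounds₁, -, hm₁, -⟩ := mem_pathSets.mp h₁
  obtain ⟨hbounds₂, hm₂, -⟩ := mem_pathSets.mp h₂
  have hinter : S₁ ∩ S₂ = {i + a.numLeaves} := by
    ext x
    rw [mem_inter, mem_singleton]
    refine ⟨fun hx => (hbounds₁ x hx.1).2.antisymm (hbounds₂ x hx.2).1, ?_⟩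
    rintro rfl
    exact ⟨hm₁, hm₂⟩
  have hcard := card_union_add_card_inter S₁ S₂
  rw [hinter, card_singleton] at hcard
  have := card_pos.mpr ⟨_, hm₁⟩
  have := card_pos.mpr ⟨_, hm₂⟩
  omega

theorem injOn_union_pathSets : Set.InjOn (fun p : Finset ℕ × Finset ℕ => p.1 ∪ p.2)
    (pathSets a i ×ˢ pathSets b (i + a.numLeaves) : Finset (Finset ℕ × Finset ℕ)) := by
  suffices h : ∀ p ∈ pathSets a i ×ˢ pathSets b (i + a.numLeaves),
      ((p.1 ∪ p.2).filter (· ≤ i + a.numLeaves), (p.1 ∪ p.2).filter (i + a.numLeaves ≤ ·)) = p by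
    intro p hp q hq hpq
    dsimp only at hpq
    rw [← h p hp, hpq, h q hq]
  rintro ⟨S₁, S₂⟩ hp
  obtain ⟨h₁, h₂⟩ := mem_product.mp hp
  obtain ⟨hbounds₁, -, hm₁, -⟩ := mem_pathSets.mp h₁
  obtain ⟨hbounds₂, hm₂, -⟩ := mem_pathSets.mp h₂
  ext x
  · simp only [mem_filter, mem_union]
    refine ⟨?_, fun hx => ⟨Or.inl hx, (hbounds₁ x hx).2⟩⟩
    rintro ⟨hx | hx, hxm⟩
    · exact hx
    · rwa [hxm.antisymm (hbounds₂ x hx).1]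
  · simp only [mem_filter, mem_union]
    refine ⟨?_, fun hx => ⟨Or.inr hx, (hbounds₂ x hx).1⟩⟩
    rintro ⟨hx | hx, hmx⟩
    · rwa [(hbounds₁ x hx).2.antisymm hmx]
    · exact hx

section

variable {A : Type*} [CommSemiring A] (y : A)

theorem sum_image₂_union_pathSets (a b : BinaryTree Unit) (i : ℕ) :
    ∑ S ∈ image₂ (· ∪ ·) (pathSets a i) (pathSets b (i + a.numLeaves)), y ^ (#S - 1) =
      (∑ S ∈ pathSets a i, y ^ (#S - 1)) *
        ∑ S ∈ pathSets b (i + a.numLeaves), y ^ (#S - 1) := by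
  rw [sum_mul_sum, ← sum_product']
  refine (sum_image injOn_union_pathSets).trans (sum_congr rfl fun p hp => ?_)
  obtain ⟨h₁, h₂⟩ := mem_product.mp hp
  rw [card_union_of_mem_pathSets h₁ h₂, pow_add]

theorem sum_pathSets (t : BinaryTree Unit) (i : ℕ) :
    ∑ S ∈ pathSets t i, y ^ (#S - 1) = pathWeight y t := by
  induction t generalizing i with
  | nil => simp [pathSets_nil, pathWeight]
  | node _ a b ha hb =>
    have hpa := a.numLeaves_pos
    have hpb := b.numLeaves_pos
    have hbase : {i, i + (a △ b).numLeaves} ∉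
        image₂ (· ∪ ·) (pathSets a i) (pathSets b (i + a.numLeaves)) := by
      rw [mem_image₂_union_pathSets, mem_insert, mem_singleton, numLeaves]
      omega
    have hcard : #{i, i + (a △ b).numLeaves} = 2 := card_pair (by rw [numLeaves]; omega)
    rw [pathSets_node, sum_insert hbase, sum_image₂_union_pathSets, ha, hb, hcard, pathWeight,
      pow_one]

theorem sum_cycleSets (t : BinaryTree Unit) (i : ℕ) :
    ∑ S ∈ cycleSets t i, y ^ (#S - 1) = cycleWeight y t := by
  induction t generalizing i with
  | nil => simp [cycleSets_nil, cycleWeight]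
  | node _ a b ha hb =>
    rw [cycleSets_node, sum_union, sum_union, ha, hb, sum_image₂_union_pathSets, sum_pathSets,
      sum_pathSets, cycleWeight]
    · rw [disjoint_left]
      intro S hS₁ hS₂
      obtain ⟨hbounds₁, hcard, -⟩ := mem_cycleSets.mp hS₁
      have hsub : S ⊆ {i + a.numLeaves} := fun x hx =>
        mem_singleton.mpr ((hbounds₁ x hx).2.antisymm ((mem_cycleSets.mp hS₂).1 x hx).1)
      have := card_le_card hsub
      rw [card_singleton] at this
      omega
    · have hpa := a.numLeaves_pos
      have hpb := b.numLeaves_pos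
      rw [disjoint_left]
      intro S hS hpath
      obtain ⟨-, hi, hj, -⟩ := mem_pathSets.mp (mem_image₂_union_pathSets.mp hpath).1
      rw [numLeaves] at hj
      rcases mem_union.mp hS with hS | hS
      · have := (mem_cycleSets.mp hS).1 _ hj
        omega
      · have := (mem_cycleSets.mp hS).1 _ hi
        omega

end

open Classical in
theorem numCycles_treeTriangulation {n k : ℕ} (hk : 3 ≤ k) {t : BinaryTree Unit}
    (ht : t.numLeaves + 1 = n) :
    numCycles (treeTriangulation n t) k = #{S ∈ cycleSets t 0 | #S = k} := by
  have hle (S : Finset (Fin n)) : polygon (S.map Fin.valEmbedding) ≤ treeGraph t 0 ↔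
      polygon S ≤ treeTriangulation n t := by
    have hmap : (polygon S).map Fin.valEmbedding = polygon (S.map Fin.valEmbedding) :=
      map_polygon (Fin.valOrderEmb n) S
    rw [← hmap]
    exact SimpleGraph.map_le_iff_le_comap _ _ _
  rw [(noncrossing_treeTriangulation n t).numCycles_eq_card]
  refine card_nbij (·.map Fin.valEmbedding) (fun S hS => ?_)
    (map_injective Fin.valEmbedding).injOn fun S hS => ?_
  · obtain ⟨rfl, hSle⟩ := (mem_filter.mp hS).2
    refine mem_filter.mpr ⟨mem_cycleSets.mpr ⟨?_, by rwa [card_map], (hle S).mpr hSle⟩, card_map _⟩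
    simp only [forall_mem_map, Fin.valEmbedding_apply]
    omega
  · obtain ⟨hScycle, rfl⟩ := mem_filter.mp hS
    obtain ⟨hbounds, -, hSle⟩ := mem_cycleSets.mp hScycle
    have hlt : ∀ x ∈ S, x < n := fun x hx => by
      have := hbounds x hx
      omega
    have hmap : (S.attachFin hlt).map Fin.valEmbedding = S := map_valEmbedding_attachFin hlt
    refine ⟨S.attachFin hlt, mem_filter.mpr ⟨mem_univ _, card_attachFin _ _, ?_⟩, hmap⟩
    rwa [← hle, hmap]

theorem numCycles_treeTriangulation_eq_coeff {R : Type*} [CommSemiring R] {n k : ℕ} (hk : 3 ≤ k)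
    {t : BinaryTree Unit} (ht : t.numLeaves + 1 = n) : (numCycles (treeTriangulation n t) k : R) =
      PowerSeries.coeff (k - 1) (cycleWeight (PowerSeries.X : PowerSeries R) t) := by
  classical
  rw [numCycles_treeTriangulation hk ht, ← sum_cycleSets _ t 0, map_sum, card_eq_sum_ones,
    sum_filter, Nat.cast_sum]
  refine sum_congr rfl fun S hS => ?_
  have hiff : #S = k ↔ k - 1 = #S - 1 := by
    have := (mem_cycleSets.mp hS).2.1
    omega
  simp only [PowerSeries.coeff_X_pow, hiff, Nat.cast_ite, Nat.cast_one, Nat.cast_zero]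

theorem sum_numCycles {R : Type*} [CommRing R] {n k : ℕ} (hk : 3 ≤ k) (hkn : k ≤ n) :
    ∑ D ∈ triangulations n, (numCycles (graph D) k : R) =
      ((2 * n - k - 1).choose (n - 1) : R) * (catalan (k - 2) : R) := by
  rw [sum_triangulations (by omega) fun G => (numCycles G k : R), ← sum_coeff_cycleWeight hk hkn]
  refine sum_congr rfl fun t ht => numCycles_treeTriangulation_eq_coeff hk ?_
  rw [numLeaves_eq_numNodes_succ, mem_treesOfNumNodesEq.mp ht]
  omega

end Weights

end PolygonDissection

theorem mainTheorem3 (n k : ℕ) (hk : 3 ≤ k) (hkn : k < n) :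
    PolygonDissection.averageCycles n k =
      ((2 * n - k - 1).choose (n - 1) : ℚ) * ((catalan (k - 2) : ℚ) / (catalan (n - 2) : ℚ)) := by
  rw [PolygonDissection.averageCycles, PolygonDissection.sum_numCycles hk hkn.le,
    PolygonDissection.card_triangulations (by omega), mul_div_assoc]
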